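/- Let $E$ be a real Banach lattice with norm dual $E^{*}$, ordered by $f\le g$ iff $f(x)\le g(x)$ for all $x\ge 0$ in $E$. A sequence $(u_n)$ in a vector lattice is disjoint if $|u_m|\wedge|u_n|=0$ for all $m\ne n$. A norm bounded set $A\subseteq E$ is called almost limited if $\sup_{x\in A}|f_n(x)|\to 0$ for every disjoint weak$^{*}$ null sequence $(f_n)$ in $E^{*}$, and it is called $L$-weakly compact if $\|x_n\|\to 0$ for every disjoint sequence $(x_n)$ in the solid hull $\{y\in E: |y|\le |x| \text{ for some } x\in A\}$ of $A$. The norm of $E$ is order continuous if every decreasing net in $E$ with infimum $0$ converges to $0$ in norm. Then: (1) Every $L$-weakly compact subset of $E$ is almost limited. (2) The norm of $E$ is order continuous if and only if every almost limited subset of $E$ is $L$-weakly compact. -/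

import Mathlib

namespace BanachLattice

open Filter Topology

set_option linter.unusedSectionVars false

section DualLattice

variable {E : Type*} [NormedAddCommGroup E] [NormedSpace ℝ E] [Lattice E] [HasSolidNorm E]
  [IsOrderedAddMonoid E]

/-- The usual order of the dual: `f ≤ g` if and only if `f x ≤ g x` for all `x ≥ 0`. -/
instance dualPartialOrder : PartialOrder (StrongDual ℝ E) where
  le f g := ∀ x : E, 0 ≤ x → f x ≤ g x
  le_refl _ _ _ := le_rfl
  le_trans _ _ _ h₁ h₂ x hx := (h₁ x hx).trans (h₂ x hx)
  le_antisymm f g h₁ h₂ := by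
    ext x
    have hp := le_antisymm (h₁ x⁺ (posPart_nonneg x)) (h₂ x⁺ (posPart_nonneg x))
    have hn := le_antisymm (h₁ x⁻ (negPart_nonneg x)) (h₂ x⁻ (negPart_nonneg x))
    rw [← posPart_sub_negPart x, map_sub, map_sub, hp, hn]

theorem dual_le_def {f g : StrongDual ℝ E} : f ≤ g ↔ ∀ x : E, 0 ≤ x → f x ≤ g x := Iff.rfl

/-- The Riesz–Kantorovich formula `f⁺ x = sup {f y : 0 ≤ y ≤ x}`, for `x ≥ 0`. -/
noncomputable def posPartOn (f : StrongDual ℝ E) (x : E) : ℝ := sSup (f '' Set.Icc 0 x)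

theorem apply_le_of_mem_Icc (f : StrongDual ℝ E) {x y : E} (hy : y ∈ Set.Icc 0 x) :
    f y ≤ ‖f‖ * ‖x‖ := by
  have h : ‖y‖ ≤ ‖x‖ := norm_le_norm_of_abs_le_abs <| by
    rw [abs_of_nonneg hy.1, abs_of_nonneg (hy.1.trans hy.2)]; exact hy.2
  exact (le_abs_self _).trans ((f.le_opNorm y).trans
    (mul_le_mul_of_nonneg_left h (norm_nonneg _)))

theorem bddAbove_image_Icc (f : StrongDual ℝ E) (x : E) : BddAbove (f '' Set.Icc 0 x) :=
  ⟨‖f‖ * ‖x‖, by rintro _ ⟨y, hy, rfl⟩; exact apply_le_of_mem_Icc f hy⟩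

theorem le_posPartOn (f : StrongDual ℝ E) {x y : E} (h0 : 0 ≤ y) (h1 : y ≤ x) :
    f y ≤ posPartOn f x :=
  le_csSup (bddAbove_image_Icc f x) ⟨y, ⟨h0, h1⟩, rfl⟩

theorem posPartOn_le (f : StrongDual ℝ E) {x : E} (hx : 0 ≤ x) {c : ℝ}
    (h : ∀ y, 0 ≤ y → y ≤ x → f y ≤ c) : posPartOn f x ≤ c :=
  csSup_le ⟨f 0, 0, ⟨le_rfl, hx⟩, rfl⟩ (by rintro _ ⟨y, hy, rfl⟩; exact h y hy.1 hy.2)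

theorem posPartOn_nonneg (f : StrongDual ℝ E) {x : E} (hx : 0 ≤ x) : 0 ≤ posPartOn f x := by
  simpa using le_posPartOn f le_rfl hx

theorem posPartOn_add (f : StrongDual ℝ E) {a b : E} (ha : 0 ≤ a) (hb : 0 ≤ b) :
    posPartOn f (a + b) = posPartOn f a + posPartOn f b := by
  apply le_antisymm
  · refine posPartOn_le f (add_nonneg ha hb) fun y h0 h1 => ?_
    have h : y = y ⊓ a + (y - y ⊓ a) := by abel
    rw [h, map_add]
    refine add_le_add (le_posPartOn f (le_inf h0 ha) inf_le_right)
      (le_posPartOn f (sub_nonneg.2 inf_le_left) ?_)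
    rw [sub_le_iff_le_add, add_comm b, inf_add]
    exact le_inf (le_add_of_nonneg_right hb) h1
  · rw [← le_sub_iff_add_le]
    refine posPartOn_le f ha fun y h0 h1 => ?_
    rw [le_sub_comm]
    refine posPartOn_le f hb fun z k0 k1 => ?_
    rw [le_sub_iff_add_le', ← map_add]
    exact le_posPartOn f (add_nonneg h0 k0) (add_le_add h1 k1)

theorem posPartOn_sub_eq (f : StrongDual ℝ E) {a b c d : E} (ha : 0 ≤ a) (hb : 0 ≤ b)
    (hc : 0 ≤ c) (hd : 0 ≤ d) (h : a - b = c - d) :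
    posPartOn f a - posPartOn f b = posPartOn f c - posPartOn f d := by
  rw [sub_eq_sub_iff_add_eq_add] at h ⊢
  rw [← posPartOn_add f ha hd, ← posPartOn_add f hc hb, h]

/-- The positive part `f⁺` of a functional, as an additive map on the whole space. -/
noncomputable def dualPosPartHom (f : StrongDual ℝ E) : E →+ ℝ where
  toFun x := posPartOn f x⁺ - posPartOn f x⁻
  map_zero' := by simp
  map_add' x y := by
    have h := posPartOn_sub_eq f (posPart_nonneg (x + y)) (negPart_nonneg (x + y))
      (add_nonneg (posPart_nonneg x) (posPart_nonneg y))
      (add_nonneg (negPart_nonneg x) (negPart_nonneg y)) (by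
        rw [add_sub_add_comm, posPart_sub_negPart, posPart_sub_negPart, posPart_sub_negPart])
    rw [h, posPartOn_add f (posPart_nonneg x) (posPart_nonneg y),
      posPartOn_add f (negPart_nonneg x) (negPart_nonneg y)]
    ring

theorem dualPosPartHom_bound (f : StrongDual ℝ E) (x : E) :
    ‖dualPosPartHom f x‖ ≤ ‖f‖ * ‖x‖ := by
  have key : ∀ z : E, 0 ≤ z → z ≤ |x| → posPartOn f z ≤ ‖f‖ * ‖x‖ := fun z h0 h1 =>
    posPartOn_le f h0 fun y k0 k1 => by
      simpa [norm_abs_eq_norm] using apply_le_of_mem_Icc f (x := |x|) ⟨k0, k1.trans h1⟩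
  have hp := key x⁺ (posPart_nonneg x) (sup_le (le_abs_self x) (abs_nonneg x))
  have hn := key x⁻ (negPart_nonneg x) (sup_le (neg_le_abs x) (abs_nonneg x))
  have hp0 := posPartOn_nonneg f (posPart_nonneg x)
  have hn0 := posPartOn_nonneg f (negPart_nonneg x)
  change |posPartOn f x⁺ - posPartOn f x⁻| ≤ _
  rw [abs_le]
  constructor <;> linarith

/-- The positive part `f⁺` of a functional `f` in the dual. -/
noncomputable def dualPosPart (f : StrongDual ℝ E) : StrongDual ℝ E :=
  (dualPosPartHom f).toRealLinearMap
    (AddMonoidHomClass.continuous_of_bound (dualPosPartHom f) ‖f‖ (dualPosPartHom_bound f))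

theorem dualPosPart_apply (f : StrongDual ℝ E) {x : E} (hx : 0 ≤ x) :
    dualPosPart f x = posPartOn f x := by
  change posPartOn f x⁺ - posPartOn f x⁻ = _
  rw [posPart_of_nonneg hx, negPart_of_nonneg hx]
  simp [posPartOn]

/-- The dual is a vector lattice for its usual order. -/
noncomputable instance dualLattice : Lattice (StrongDual ℝ E) where
  __ := dualPartialOrder
  sup f g := g + dualPosPart (f - g)
  inf f g := f - dualPosPart (f - g)
  le_sup_left f g x hx := by
    have := le_posPartOn (f - g) hx le_rfl
    simp only [add_apply, sub_apply,
      dualPosPart_apply _ hx] at this ⊢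
    linarith
  le_sup_right f g x hx := by
    have := posPartOn_nonneg (f - g) hx
    simp only [add_apply, dualPosPart_apply _ hx]
    linarith
  sup_le f g h hf hg x hx := by
    have : posPartOn (f - g) x ≤ h x - g x := posPartOn_le _ hx fun y h0 h1 => by
      have k1 := hf y h0
      have k2 := hg (x - y) (sub_nonneg.2 h1)
      simp only [map_sub, sub_apply] at k2 ⊢
      linarith
    simp only [add_apply, dualPosPart_apply _ hx]
    linarith
  inf_le_left f g x hx := by
    have := posPartOn_nonneg (f - g) hx
    simp only [sub_apply, dualPosPart_apply _ hx]
    linarith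
  inf_le_right f g x hx := by
    have := le_posPartOn (f - g) hx le_rfl
    simp only [sub_apply, dualPosPart_apply _ hx] at this ⊢
    linarith
  le_inf h f g hf hg x hx := by
    have : posPartOn (f - g) x ≤ f x - h x := posPartOn_le _ hx fun y h0 h1 => by
      have k1 := hg y h0
      have k2 := hf (x - y) (sub_nonneg.2 h1)
      simp only [map_sub, sub_apply] at k2 ⊢
      linarith
    simp only [sub_apply, dualPosPart_apply _ hx]
    linarith

end DualLattice

/-- A sequence in a vector lattice is disjoint if `|x m| ∧ |x n| = 0` whenever `m ≠ n`. -/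
def IsDisjointSeq {V : Type*} [AddCommGroup V] [Lattice V] (x : ℕ → V) : Prop :=
  Pairwise fun m n => |x m| ⊓ |x n| = 0

section Notions

variable {E : Type*} [NormedAddCommGroup E] [NormedSpace ℝ E] [Lattice E] [HasSolidNorm E]
  [IsOrderedAddMonoid E]

/-- A norm bounded set on which every disjoint weak* null sequence of functionals converges
uniformly to zero. -/
def IsAlmostLimited (A : Set E) : Prop :=
  Bornology.IsBounded A ∧ ∀ f : ℕ → StrongDual ℝ E, IsDisjointSeq f →
    Tendsto (fun n => StrongDual.toWeakDual (f n)) atTop (𝓝 0) →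
    TendstoUniformlyOn (fun n x => f n x) (fun _ => 0) atTop A

end Notions

/-- A norm bounded set such that every disjoint sequence in its solid hull is norm null. -/
def IsLWeaklyCompact {E : Type*} [NormedAddCommGroup E] [Lattice E] (A : Set E) : Prop :=
  Bornology.IsBounded A ∧ ∀ x : ℕ → E,
    (∀ n, x n ∈ LatticeOrderedAddCommGroup.solidClosure A) → IsDisjointSeq x →
    Tendsto (fun n => ‖x n‖) atTop (𝓝 0)

/-- The norm is order continuous: every downward directed set with infimum zero, regarded as a
decreasing net, converges to zero in norm. -/
def HasOrderContinuousNorm (E : Type*) [NormedAddCommGroup E] [Lattice E] : Prop :=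
  ∀ D : Set E, D.Nonempty → DirectedOn (· ≥ ·) D → IsGLB D 0 →
    ∀ ε : ℝ, 0 < ε → ∃ x ∈ D, ∀ y ∈ D, y ≤ x → ‖y‖ < ε

end BanachLattice

namespace BanachLattice

open Filter Topology

set_option linter.unusedSectionVars false

/-! Everything passes through one local condition on `u`: disjoint sequences in `[0, u]` are norm
null (`IsDisjointNullBelow`). It makes monotone sequences in `[0, u]` norm Cauchy, and its validity
for all `u ≥ 0` is equivalent to order continuity of the norm. Singletons are almost limited, so if
almost limited sets are L-weakly compact, the condition holds for every `u ≥ 0`.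

Conversely, let the norm be order continuous, `A` almost limited, and `x n` disjoint with `|x n| ≤
|a n|`, `a n ∈ A`. Restrict a positive norming functional of `|x n|` to the band generated by `|x
n|`. The restrictions `g n` are disjoint, and weak* null because their values at `y ≥ 0` are
approximated on a disjoint sequence in `[0, y]`. Changing signs gives `h n` with `|h n| ≤ g n` and
`h n (a n) = g n |a n| ≥ ‖x n‖`; almost limitedness forces this to zero.

For (1), suppose `|f n (x n)| ≥ ε` along a subsequence, with `x n ∈ A`. The local condition holds at
each `|x m|`, and it makes the disjoint bounded functionals `|f n|` tend to zero there. Thinning out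
makes `|f j| |x i|` tiny for `i < j`, and a disjointification produces disjoint `w n ≤ |x n|` that
are not norm null. -/

theorem inf_eq_zero_of_le {L : Type*} [Lattice L] [Zero L] {a b c d : L}
    (ha : 0 ≤ a) (hb : 0 ≤ b) (hac : a ≤ c) (hbd : b ≤ d) (h : c ⊓ d = 0) : a ⊓ b = 0 :=
  le_antisymm ((inf_le_inf hac hbd).trans h.le) (le_inf ha hb)

/-- If `x` is not Cauchy, some `φ N ≥ N` has `x (φ N)` at distance at least `ε` from `x N`; the
iterates of `φ` form a reindexing with increments bounded below. -/
theorem cauchySeq_of_forall_monotone {F : Type*} [SeminormedAddCommGroup F] {x : ℕ → F}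
    (h : ∀ k : ℕ → ℕ, Monotone k → Tendsto (fun n => ‖x (k (n + 1)) - x (k n)‖) atTop (𝓝 0)) :
    CauchySeq x := by
  rw [Metric.cauchySeq_iff']
  by_contra! hcon
  obtain ⟨ε, hε, hcon⟩ := hcon
  choose φ hφ hφε using hcon
  have hk : Monotone fun n => φ^[n] 0 := monotone_nat_of_le_succ fun n => by
    rw [Function.iterate_succ_apply']; exact hφ _
  obtain ⟨n, hn⟩ := ((h _ hk).eventually (gt_mem_nhds hε)).exists
  have := hφε (φ^[n] 0)
  rw [dist_eq_norm, ← Function.iterate_succ_apply' φ] at this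
  exact hn.not_ge this

/-! ### Disjointness and level crossings in vector lattices -/

section VectorLattice

variable {V : Type*} [AddCommGroup V] [Lattice V] [IsOrderedAddMonoid V]

theorem add_inf_le_inf_add_inf {a b c : V} (ha : 0 ≤ a) (hb : 0 ≤ b) (hc : 0 ≤ c) :
    (a + b) ⊓ c ≤ a ⊓ c + b ⊓ c := by
  rw [add_inf, inf_add, inf_add]
  exact le_inf (le_inf inf_le_left (inf_le_right.trans (le_add_of_nonneg_right hb)))
    (le_inf (inf_le_right.trans (le_add_of_nonneg_left ha))
      (inf_le_right.trans (le_add_of_nonneg_right hc)))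

theorem sum_inf_eq_zero {ι : Type*} (s : Finset ι) {a : ι → V} {c : V} (ha : ∀ i ∈ s, 0 ≤ a i)
    (hc : 0 ≤ c) (h : ∀ i ∈ s, a i ⊓ c = 0) : (∑ i ∈ s, a i) ⊓ c = 0 := by
  classical
  induction s using Finset.induction_on with
  | empty => simpa using hc
  | insert i s hi ih =>
    rw [Finset.sum_insert hi]
    have h0 := ha i (Finset.mem_insert_self i s)
    have hs : 0 ≤ ∑ j ∈ s, a j := Finset.sum_nonneg fun j hj => ha j (Finset.mem_insert_of_mem hj)
    refine le_antisymm ((add_inf_le_inf_add_inf h0 hs hc).trans ?_)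
      (le_inf (add_nonneg h0 hs) hc)
    rw [h i (Finset.mem_insert_self i s), ih (fun j hj => ha j (Finset.mem_insert_of_mem hj))
      (fun j hj => h j (Finset.mem_insert_of_mem hj)), add_zero]

theorem nsmul_inf_eq_zero {a c : V} (ha : 0 ≤ a) (hc : 0 ≤ c) (h : a ⊓ c = 0) (k : ℕ) :
    (k • a) ⊓ c = 0 := by
  simpa using sum_inf_eq_zero (Finset.range k) (a := fun _ => a) (fun _ _ => ha) hc fun _ _ => h

theorem posPart_sub_inf_posPart_sub (a b : V) : (a - b)⁺ ⊓ (b - a)⁺ = 0 := by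
  have := posPart_inf_negPart_eq_zero (a - b)
  rwa [← posPart_neg, neg_sub] at this

/-- The part of a jump from `a` to `b` exceeding `e` is controlled by the crossings of the levels
`j • e`. -/
theorem posPart_sub_sub_le_sum (a b e : V) (ha : 0 ≤ a) (hb : 0 ≤ b) (he : 0 ≤ e) (J : ℕ)
    (hJ : b ≤ J • e) :
    (b - a - e)⁺ ≤ ∑ j ∈ Finset.range J, (b - j • e)⁺ ⊓ (j • e - a)⁺ := by
  -- Truncate `b` at height `k • e`. Passing from `k` to `k + 1` adds at most `(b - k • e)⁺`, and
  -- the new left side is itself at most `(k • e - a)⁺`.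
  have key : ∀ k : ℕ, (b ⊓ k • e - a - e)⁺ ≤
      ∑ j ∈ Finset.range k, (b - j • e)⁺ ⊓ (j • e - a)⁺ := by
    intro k
    induction k with
    | zero =>
      simp only [zero_smul, inf_eq_right.2 hb, Finset.range_zero, Finset.sum_empty]
      exact (posPart_eq_zero.2 (by
        rw [zero_sub, ← neg_add']; exact neg_nonpos.2 (add_nonneg ha he))).le
    | succ k ih =>
      rw [Finset.sum_range_succ]
      refine le_trans ?_ (add_le_add_left ih _)
      rw [← sub_le_iff_le_add']
      refine le_inf ?_ ?_
      · rw [sub_le_iff_le_add']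
        refine sup_le ?_ (add_nonneg (posPart_nonneg _) (posPart_nonneg _))
        have h1 : b ⊓ (k + 1) • e ≤ b ⊓ k • e + (b - k • e)⁺ := by
          rw [inf_add]
          refine le_inf (inf_le_left.trans (le_add_of_nonneg_right (posPart_nonneg _)))
            (inf_le_left.trans ?_)
          have := le_posPart (b - k • e)
          rwa [sub_le_iff_le_add'] at this
        calc b ⊓ (k + 1) • e - a - e ≤ b ⊓ k • e + (b - k • e)⁺ - a - e := by gcongr
          _ = (b ⊓ k • e - a - e) + (b - k • e)⁺ := by abel
          _ ≤ _ := by gcongr; exact le_posPart _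
      · refine (sub_le_self _ (posPart_nonneg _)).trans (posPart_mono ?_)
        calc b ⊓ (k + 1) • e - a - e ≤ (k + 1) • e - a - e := by gcongr; exact inf_le_right
          _ = k • e - a := by rw [succ_nsmul]; abel
  simpa [inf_eq_left.2 hJ] using key J

theorem isDisjointSeq_of_nonneg {x : ℕ → V} (h0 : ∀ n, 0 ≤ x n)
    (h : ∀ m n, m < n → x m ⊓ x n = 0) : IsDisjointSeq x := by
  intro m n hmn
  simp only [abs_of_nonneg (h0 _)]
  rcases hmn.lt_or_gt with h1 | h1
  · exact h m n h1
  · rw [inf_comm]; exact h n m h1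

/-- Partial sums of a disjoint positive sequence stay below its upper bounds. -/
theorem IsDisjointSeq.sum_range_le {x : ℕ → V} (hx : IsDisjointSeq x) {u : V}
    (hxu : ∀ n, x n ∈ Set.Icc 0 u) (n : ℕ) : ∑ i ∈ Finset.range n, x i ≤ u := by
  induction n with
  | zero => simpa using (hxu 0).1.trans (hxu 0).2
  | succ n ih =>
    have h : (∑ i ∈ Finset.range n, x i) ⊓ x n = 0 :=
      sum_inf_eq_zero _ (fun i _ => (hxu i).1) (hxu n).1 fun i hi => by
        have : |x i| ⊓ |x n| = 0 := hx (Finset.mem_range.1 hi).ne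
        rwa [abs_of_nonneg (hxu i).1, abs_of_nonneg (hxu n).1] at this
    rw [Finset.sum_range_succ, ← inf_add_sup, h, zero_add]
    exact sup_le ih (hxu n).2

end VectorLattice

/-! ### Order continuity through disjoint sequences -/

section OrderContinuity

variable {E : Type*} [NormedAddCommGroup E] [Lattice E] [HasSolidNorm E] [IsOrderedAddMonoid E]

theorem norm_le_norm_of_nonneg_of_le {x y : E} (hx : 0 ≤ x) (hxy : x ≤ y) : ‖x‖ ≤ ‖y‖ :=
  norm_le_norm_of_abs_le_abs <| by
    rwa [abs_of_nonneg hx, abs_of_nonneg (hx.trans hxy)]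

/-- Every disjoint sequence in the order interval `[0, u]` is norm null. -/
def IsDisjointNullBelow (u : E) : Prop :=
  ∀ x : ℕ → E, (∀ n, x n ∈ Set.Icc 0 u) → IsDisjointSeq x → Tendsto (fun n => ‖x n‖) atTop (𝓝 0)

variable [NormedSpace ℝ E] [IsOrderedModule ℝ E]

/-- Cut `[0, u]` by the levels `j • e` with `e = u / N` of norm below `ε / 2`. A monotone sequence
crosses a level essentially once: for `m < n` the crossing terms lie below `(x n - j • e)⁺` and `(j
• e - x n)⁺`, hence are disjoint. So they are norm null at each of the finitely many levels, and the
rest of a jump is at most `e`. -/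
theorem IsDisjointNullBelow.tendsto_norm_sub {u : E} (hu : IsDisjointNullBelow u) {x : ℕ → E}
    (hx : Monotone x) (hxu : ∀ n, x n ∈ Set.Icc 0 u) :
    Tendsto (fun n => ‖x (n + 1) - x n‖) atTop (𝓝 0) := by
  have hu0 : 0 ≤ u := (hxu 0).1.trans (hxu 0).2
  rw [Metric.tendsto_atTop']
  intro ε hε
  obtain ⟨N, hN⟩ := exists_nat_gt (2 * ‖u‖ / ε)
  have hN0 : (0 : ℝ) < N := (by positivity : (0 : ℝ) ≤ 2 * ‖u‖ / ε).trans_lt hN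
  set e : E := (N : ℝ)⁻¹ • u with he_def
  have he : 0 ≤ e := smul_nonneg (by positivity) hu0
  have hNe : N • e = u := by
    rw [he_def, ← Nat.cast_smul_eq_nsmul ℝ, smul_smul, mul_inv_cancel₀ hN0.ne', one_smul]
  have hne : ‖e‖ < ε / 2 := by
    rw [he_def, norm_smul, norm_inv, Real.norm_natCast, inv_mul_lt_iff₀ hN0]
    rw [div_lt_iff₀ hε] at hN
    linarith
  let c : ℕ → ℕ → E := fun j n => (x (n + 1) - j • e)⁺ ⊓ (j • e - x n)⁺
  have hc0 : ∀ j n, 0 ≤ c j n := fun j n => le_inf (posPart_nonneg _) (posPart_nonneg _)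
  have hc : ∀ j, Tendsto (fun n => ‖c j n‖) atTop (𝓝 0) := by
    intro j
    refine hu _ (fun n => ⟨hc0 j n, inf_le_left.trans (sup_le ?_ hu0)⟩)
      (isDisjointSeq_of_nonneg (hc0 j) fun m n hmn => ?_)
    · exact (sub_le_self _ (nsmul_nonneg he j)).trans (hxu _).2
    · exact inf_eq_zero_of_le (hc0 j m) (hc0 j n)
        (inf_le_left.trans (posPart_mono (sub_le_sub_right (hx hmn) _))) inf_le_right
        (posPart_sub_inf_posPart_sub (x n) (j • e))
  have hs : Tendsto (fun n => ∑ j ∈ Finset.range N, ‖c j n‖) atTop (𝓝 0) := by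
    simpa using tendsto_finsetSum (Finset.range N) fun j _ => hc j
  obtain ⟨n₀, hn₀⟩ := (Metric.tendsto_atTop.1 hs) (ε / 2) (half_pos hε)
  refine ⟨n₀, fun n hn => ?_⟩
  have h1 := hn₀ n hn.le
  rw [Real.dist_eq, sub_zero, abs_of_nonneg (Finset.sum_nonneg fun _ _ => norm_nonneg _)] at h1
  rw [Real.dist_eq, sub_zero, abs_norm]
  have h2 : x (n + 1) - x n ≤ (∑ j ∈ Finset.range N, c j n) + e := by
    rw [← sub_le_iff_le_add]
    exact (le_posPart _).trans (posPart_sub_sub_le_sum _ _ e (hxu n).1 (hxu _).1 he N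
      (hNe ▸ (hxu _).2))
  calc ‖x (n + 1) - x n‖ ≤ ‖(∑ j ∈ Finset.range N, c j n) + e‖ :=
        norm_le_norm_of_nonneg_of_le (sub_nonneg.2 (hx n.le_succ)) h2
    _ ≤ (∑ j ∈ Finset.range N, ‖c j n‖) + ‖e‖ :=
        (norm_add_le _ _).trans (add_le_add_left (norm_sum_le _ _) _)
    _ < ε := by linarith

theorem IsDisjointNullBelow.tendsto_norm_sub_of_antitone {u : E} (hu : IsDisjointNullBelow u)
    {x : ℕ → E} (hx : Antitone x) (hxu : ∀ n, x n ∈ Set.Icc 0 u) :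
    Tendsto (fun n => ‖x (n + 1) - x n‖) atTop (𝓝 0) := by
  have := hu.tendsto_norm_sub (x := fun n => u - x n) (fun m n h => sub_le_sub_left (hx h) u)
    fun n => ⟨sub_nonneg.2 (hxu n).2, sub_le_self _ (hxu n).1⟩
  refine this.congr fun n => ?_
  rw [sub_sub_sub_cancel_left, norm_sub_rev]

theorem IsDisjointNullBelow.cauchySeq {u : E} (hu : IsDisjointNullBelow u) {x : ℕ → E}
    (hx : Monotone x) (hxu : ∀ n, x n ∈ Set.Icc 0 u) : CauchySeq x :=
  cauchySeq_of_forall_monotone fun k hk =>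
    hu.tendsto_norm_sub (x := x ∘ k) (hx.comp hk) fun n => hxu (k n)

theorem IsDisjointNullBelow.cauchySeq_of_antitone {u : E} (hu : IsDisjointNullBelow u)
    {x : ℕ → E} (hx : Antitone x) (hxu : ∀ n, x n ∈ Set.Icc 0 u) : CauchySeq x :=
  cauchySeq_of_forall_monotone fun k hk =>
    hu.tendsto_norm_sub_of_antitone (x := x ∘ k) (hx.comp_monotone hk) fun n => hxu (k n)

theorem HasOrderContinuousNorm.isDisjointNullBelow (h : HasOrderContinuousNorm E) (u : E) :
    IsDisjointNullBelow u := by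
  intro x hxu hx
  let s : ℕ → E := fun n => ∑ i ∈ Finset.range n, x i
  have hs : Monotone s := monotone_nat_of_le_succ fun n => by
    simp only [s, Finset.sum_range_succ]; exact le_add_of_nonneg_right (hxu n).1
  -- The partial sums may have no supremum, so all their upper bounds enter. If `w` is a lower bound
  -- of `D`, subtracting `w` from an upper bound leaves an upper bound; iterating from `u` gives `k
  -- • w ≤ u` for all `k`, so `w ≤ 0`.
  let D : Set E := {d | ∃ v, (∀ n, s n ≤ v) ∧ ∃ n, d = v - s n}
  have hsu : ∀ n, s n ≤ u := hx.sum_range_le hxu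
  have hglb : IsGLB D 0 := by
    refine ⟨?_, fun w hw => ?_⟩
    · rintro _ ⟨v, hv, n, rfl⟩
      exact sub_nonneg.2 (hv n)
    · have hk : ∀ k : ℕ, ∀ n, s n ≤ u - k • w := by
        intro k
        induction k with
        | zero => simpa using hsu
        | succ k ih =>
          intro n
          have := hw ⟨_, ih, n, rfl⟩
          rw [succ_nsmul, ← sub_sub]
          exact le_sub_comm.1 this
      have hw' : ∀ k : ℕ, w ≤ ((k : ℝ) + 1)⁻¹ • u := by
        intro k
        have h1 : (k + 1) • w ≤ u := by
          have := hk (k + 1) 0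
          simpa [s] using this
        have hp : (0 : ℝ) < (k : ℝ) + 1 := by positivity
        rw [← Nat.cast_smul_eq_nsmul ℝ, Nat.cast_succ] at h1
        have := smul_le_smul_of_nonneg_left h1 (inv_pos.2 hp).le
        rwa [smul_smul, inv_mul_cancel₀ hp.ne', one_smul] at this
      have ht : Tendsto (fun k : ℕ => ((k : ℝ) + 1)⁻¹ • u) atTop (𝓝 0) := by
        have := (tendsto_one_div_add_atTop_nhds_zero_nat (𝕜 := ℝ)).smul_const u
        simpa using this
      exact ge_of_tendsto' ht hw'
  have hdir : DirectedOn (· ≥ ·) D := by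
    rintro _ ⟨v, hv, n, rfl⟩ _ ⟨v', hv', n', rfl⟩
    exact ⟨v ⊓ v' - s (max n n'), ⟨_, fun n => le_inf (hv n) (hv' n), _, rfl⟩,
      sub_le_sub inf_le_left (hs (le_max_left _ _)),
      sub_le_sub inf_le_right (hs (le_max_right _ _))⟩
  rw [Metric.tendsto_atTop]
  intro ε hε
  obtain ⟨_, ⟨v, hv, n, rfl⟩, hd⟩ := h D ⟨_, u, hsu, 0, rfl⟩ hdir hglb ε hε
  refine ⟨n, fun m hm => ?_⟩
  rw [Real.dist_eq, sub_zero, abs_norm]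
  refine (norm_le_norm_of_nonneg_of_le (hxu m).1 ?_).trans_lt (hd _ ⟨v, hv, n, rfl⟩ le_rfl)
  have h1 := hv (m + 1)
  simp only [s, Finset.sum_range_succ] at h1
  rw [le_sub_iff_add_le']
  exact (add_le_add_left (hs hm) _).trans h1

/-- The oscillation of `D` below a suitable element is arbitrarily small, since otherwise a
decreasing sequence would have gaps bounded below. A decreasing sequence of such elements converges
in norm, and by directedness its limit is a lower bound of `D`, hence zero. -/
theorem hasOrderContinuousNorm_of_isDisjointNullBelow [CompleteSpace E]
    (h : ∀ u : E, 0 ≤ u → IsDisjointNullBelow u) : HasOrderContinuousNorm E := by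
  intro D hne hdir hglb ε hε
  have hD0 : ∀ d ∈ D, 0 ≤ d := fun d hd => hglb.1 hd
  have hosc : ∀ d ∈ D, ∀ δ : ℝ, 0 < δ → ∃ x ∈ D, x ≤ d ∧ ∀ y ∈ D, y ≤ x → ‖x - y‖ < δ := by
    intro d hd δ hδ
    by_contra! hcon
    have hcon' : ∀ x : {x // x ∈ D ∧ x ≤ d}, ∃ y : {x // x ∈ D ∧ x ≤ d}, y.1 ≤ x.1 ∧
        δ ≤ ‖x.1 - y.1‖ := by
      rintro ⟨x, hx, hxd⟩
      obtain ⟨y, hy, hyx, hδy⟩ := hcon x hx hxd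
      exact ⟨⟨y, hy, hyx.trans hxd⟩, hyx, hδy⟩
    choose φ hφ hφδ using hcon'
    let x : ℕ → {x // x ∈ D ∧ x ≤ d} := fun n => φ^[n] ⟨d, hd, le_rfl⟩
    have hx : ∀ n, x (n + 1) = φ (x n) := fun n => Function.iterate_succ_apply' _ _ _
    have hanti : Antitone fun n => (x n).1 := antitone_nat_of_succ_le fun n => by
      rw [hx]; exact hφ _
    have ht := (h d (hD0 d hd)).tendsto_norm_sub_of_antitone hanti
      fun n => ⟨hD0 _ (x n).2.1, (x n).2.2⟩
    obtain ⟨n, hn⟩ := (ht.eventually (gt_mem_nhds hδ)).exists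
    have := hφδ (x n)
    rw [norm_sub_rev, ← hx] at this
    exact hn.not_ge this
  obtain ⟨d₀, hd₀⟩ := hne
  have hchoice : ∀ (n : ℕ) (d : {d // d ∈ D}), ∃ x : {d // d ∈ D}, x.1 ≤ d.1 ∧
      ∀ y ∈ D, y ≤ x.1 → ‖x.1 - y‖ < 1 / ((n : ℝ) + 1) := by
    rintro n ⟨d, hd⟩
    obtain ⟨x, hx, hxd, hy⟩ := hosc d hd (1 / ((n : ℝ) + 1)) (by positivity)
    exact ⟨⟨x, hx⟩, hxd, hy⟩
  choose φ hφ hφn using hchoice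
  let z : ℕ → {d // d ∈ D} := fun n => Nat.rec ⟨d₀, hd₀⟩ (fun n d => φ n d) n
  have hz : ∀ n, z (n + 1) = φ n (z n) := fun n => rfl
  have hanti : Antitone fun n => (z n).1 := antitone_nat_of_succ_le fun n => by
    rw [hz]; exact hφ _ _
  have hosc' : ∀ n, ∀ y ∈ D, y ≤ (z (n + 1)).1 → ‖(z (n + 1)).1 - y‖ < 1 / ((n : ℝ) + 1) :=
    fun n => hφn n (z n)
  have hcs : CauchySeq fun n => (z n).1 :=
    (h d₀ (hD0 d₀ hd₀)).cauchySeq_of_antitone hanti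
      fun n => ⟨hD0 _ (z n).2, hanti (Nat.zero_le n)⟩
  obtain ⟨x, hx⟩ := cauchySeq_tendsto_of_complete hcs
  have hx1 : Tendsto (fun n => (z (n + 1)).1) atTop (𝓝 x) := hx.comp (tendsto_add_atTop_nat 1)
  have hx0 : 0 ≤ x := ge_of_tendsto' hx fun n => hD0 _ (z n).2
  have hxlb : x ∈ lowerBounds D := by
    intro d hd
    have hy : ∀ n, ∃ y ∈ D, y ≤ (z (n + 1)).1 ∧ y ≤ d := fun n => by
      obtain ⟨y, hy, h1, h2⟩ := hdir _ (z (n + 1)).2 _ hd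
      exact ⟨y, hy, h1, h2⟩
    choose y hyD hyz hyd using hy
    have h0 : Tendsto (fun n => (z (n + 1)).1 - y n) atTop (𝓝 0) :=
      squeeze_zero_norm (fun n => (hosc' n _ (hyD n) (hyz n)).le)
        tendsto_one_div_add_atTop_nhds_zero_nat
    have h1 : Tendsto y atTop (𝓝 x) := by
      simpa using hx1.sub h0
    exact le_of_tendsto' h1 hyd
  have hxz : x = 0 := le_antisymm (hglb.2 hxlb) hx0
  rw [hxz] at hx
  obtain ⟨n, hn⟩ := ((tendsto_zero_iff_norm_tendsto_zero.1 hx).eventually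
    (gt_mem_nhds hε)).exists
  exact ⟨(z n).1, (z n).2, fun y hy hyz =>
    (norm_le_norm_of_nonneg_of_le (hD0 y hy) hyz).trans_lt hn⟩

end OrderContinuity

theorem tendsto_toWeakDual_zero_iff {E : Type*} [SeminormedAddCommGroup E]
    [NormedSpace ℝ E] {f : ℕ → StrongDual ℝ E} :
    Tendsto (fun n => StrongDual.toWeakDual (f n)) atTop (𝓝 0) ↔
      ∀ x, Tendsto (fun n => f n x) atTop (𝓝 0) :=
  tendsto_iff_forall_eval_tendsto_topDualPairing

theorem tendstoUniformlyOn_zero_iff {E : Type*} [SeminormedAddCommGroup E]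
    [NormedSpace ℝ E] {f : ℕ → StrongDual ℝ E}
    {A : Set E} :
    TendstoUniformlyOn (fun n x => f n x) (fun _ => 0) atTop A ↔
      ∀ ε > 0, ∀ᶠ n in atTop, ∀ x ∈ A, |f n x| < ε := by
  simp [Metric.tendstoUniformlyOn_iff, Real.dist_eq]

/-! ### Positive and disjoint functionals -/

section Dual

variable {E : Type*} [NormedAddCommGroup E] [NormedSpace ℝ E] [Lattice E] [HasSolidNorm E]
  [IsOrderedAddMonoid E]

instance dualIsOrderedAddMonoid : IsOrderedAddMonoid (StrongDual ℝ E) where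
  add_le_add_left f g h k x hx := by
    have := h x hx
    simp only [add_apply]
    linarith

theorem dual_apply_nonneg {f : StrongDual ℝ E} (hf : 0 ≤ f) {x : E} (hx : 0 ≤ x) : 0 ≤ f x :=
  hf x hx

theorem dual_apply_mono {f : StrongDual ℝ E} (hf : 0 ≤ f) {x y : E} (hxy : x ≤ y) : f x ≤ f y := by
  have := dual_apply_nonneg hf (sub_nonneg.2 hxy)
  rw [map_sub] at this
  linarith

theorem abs_dual_apply_le (f : StrongDual ℝ E) (x : E) : |f x| ≤ |f| |x| := by
  have hpos : ∀ y : E, 0 ≤ y → |f y| ≤ |f| y := fun y hy =>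
    abs_le'.2 ⟨le_abs_self f y hy, neg_le_abs f y hy⟩
  calc |f x| = |f x⁺ - f x⁻| := by rw [← map_sub, posPart_sub_negPart]
    _ ≤ |f x⁺| + |f x⁻| := abs_sub _ _
    _ ≤ |f| x⁺ + |f| x⁻ := add_le_add (hpos _ (posPart_nonneg x)) (hpos _ (negPart_nonneg x))
    _ = |f| |x| := by rw [← map_add, posPart_add_negPart]

theorem posPartOn_le_norm (f : StrongDual ℝ E) {x : E} (hx : 0 ≤ x) :
    posPartOn f x ≤ ‖f‖ * ‖x‖ :=
  posPartOn_le f hx fun _ h0 h1 => apply_le_of_mem_Icc f ⟨h0, h1⟩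

theorem abs_dual_apply_le_norm (f : StrongDual ℝ E) {x : E} (hx : 0 ≤ x) :
    |f| x ≤ 2 * ‖f‖ * ‖x‖ := by
  have h : |f| ≤ dualPosPart f + dualPosPart (-f) := by
    refine sup_le (fun y hy => ?_) fun y hy => ?_
    · have h1 := le_posPartOn f hy le_rfl
      have h2 := posPartOn_nonneg (-f) hy
      rw [add_apply, dualPosPart_apply _ hy, dualPosPart_apply _ hy]
      linarith
    · have h1 := le_posPartOn (-f) hy le_rfl
      have h2 := posPartOn_nonneg f hy
      rw [add_apply, dualPosPart_apply _ hy, dualPosPart_apply _ hy]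
      linarith
  have h1 := h x hx
  rw [add_apply, dualPosPart_apply _ hx, dualPosPart_apply _ hx] at h1
  have h2 := posPartOn_le_norm f hx
  have h3 := posPartOn_le_norm (-f) hx
  rw [norm_neg] at h3
  linarith

/-- Disjoint functionals nearly split each positive vector. -/
theorem exists_split_of_inf_eq_zero {f g : StrongDual ℝ E} (h : f ⊓ g = 0) {x : E} (hx : 0 ≤ x)
    {δ : ℝ} (hδ : 0 < δ) : ∃ v ∈ Set.Icc 0 x, f (x - v) + g v < δ := by
  by_contra! hcon
  have h1 : posPartOn (f - g) x ≤ f x - δ := posPartOn_le _ hx fun y h0 h1 => by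
    have := hcon y ⟨h0, h1⟩
    rw [map_sub] at this
    rw [sub_apply]
    linarith
  have h2 : (f ⊓ g) x = f x - posPartOn (f - g) x := by
    change (f - dualPosPart (f - g)) x = _
    rw [sub_apply, dualPosPart_apply _ hx]
  rw [h, zero_apply] at h2
  linarith

theorem inf_eq_zero_of_exists_split {f g : StrongDual ℝ E} (hf : 0 ≤ f) (hg : 0 ≤ g)
    (h : ∀ x : E, 0 ≤ x → ∀ δ : ℝ, 0 < δ → ∃ v ∈ Set.Icc 0 x, f (x - v) + g v ≤ δ) :
    f ⊓ g = 0 := by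
  refine le_antisymm (fun x hx => ?_) (le_inf hf hg)
  rw [zero_apply]
  refine le_of_forall_pos_le_add fun δ hδ => ?_
  obtain ⟨v, hv, hvδ⟩ := h x hx δ hδ
  have h1 : (f ⊓ g) (x - v) ≤ f (x - v) := (inf_le_left : f ⊓ g ≤ f) _ (sub_nonneg.2 hv.2)
  have h2 : (f ⊓ g) v ≤ g v := (inf_le_right : f ⊓ g ≤ g) _ hv.1
  rw [map_sub] at h1
  linarith

/-! ### Band components of functionals -/

/-- An additive function on the positive cone dominated by a positive functional extends to a
functional. -/
theorem exists_dual_eq_of_additive {f : StrongDual ℝ E} (p : E → ℝ)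
    (hp0 : ∀ y, 0 ≤ y → 0 ≤ p y) (hpf : ∀ y, 0 ≤ y → p y ≤ f y)
    (hadd : ∀ y z, 0 ≤ y → 0 ≤ z → p (y + z) = p y + p z) :
    ∃ g : StrongDual ℝ E, ∀ y, 0 ≤ y → g y = p y := by
  have hz : p 0 = 0 := by simpa using hadd 0 0 le_rfl le_rfl
  let φ : E →+ ℝ :=
    { toFun := fun x => p x⁺ - p x⁻
      map_zero' := by simp
      map_add' := fun x y => by
        have h : (x + y)⁺ + (x⁻ + y⁻) = (x⁺ + y⁺) + (x + y)⁻ := by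
          rw [← sub_eq_sub_iff_add_eq_add, add_sub_add_comm, posPart_sub_negPart,
            posPart_sub_negPart, posPart_sub_negPart]
        have h' := congrArg p h
        rw [hadd _ _ (posPart_nonneg _) (add_nonneg (negPart_nonneg _) (negPart_nonneg _)),
          hadd _ _ (negPart_nonneg _) (negPart_nonneg _),
          hadd _ _ (add_nonneg (posPart_nonneg _) (posPart_nonneg _)) (negPart_nonneg _),
          hadd _ _ (posPart_nonneg _) (posPart_nonneg _)] at h'
        linarith }
  have hφ : ∀ x, ‖φ x‖ ≤ ‖f‖ * ‖x‖ := by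
    intro x
    have key : ∀ z : E, 0 ≤ z → z ≤ |x| → p z ≤ ‖f‖ * ‖x‖ := fun z h0 h1 =>
      (hpf z h0).trans (by
        simpa [norm_abs_eq_norm] using apply_le_of_mem_Icc f (x := |x|) ⟨h0, h1⟩)
    have hp := key x⁺ (posPart_nonneg x) (sup_le (le_abs_self x) (abs_nonneg x))
    have hn := key x⁻ (negPart_nonneg x) (sup_le (neg_le_abs x) (abs_nonneg x))
    have hp0' := hp0 _ (posPart_nonneg x)
    have hn0' := hp0 _ (negPart_nonneg x)
    change |p x⁺ - p x⁻| ≤ _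
    rw [abs_le]
    constructor <;> linarith
  refine ⟨φ.toRealLinearMap (AddMonoidHomClass.continuous_of_bound φ ‖f‖ hφ), fun y hy => ?_⟩
  change p y⁺ - p y⁻ = p y
  rw [posPart_of_nonneg hy, negPart_of_nonneg hy, hz, sub_zero]

/-- `g` is the component of the positive functional `f` carried by the band generated by `x`. -/
structure IsBandPart (f : StrongDual ℝ E) (x : E) (g : StrongDual ℝ E) : Prop where
  nonneg : 0 ≤ g
  le : g ≤ f
  tendsto : ∀ y, 0 ≤ y → Tendsto (fun k : ℕ => f (y ⊓ k • x)) atTop (𝓝 (g y))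

theorem exists_isBandPart {f : StrongDual ℝ E} (hf : 0 ≤ f) {x : E} (hx : 0 ≤ x) :
    ∃ g, IsBandPart f x g := by
  have hlim : ∀ y, ∃ c, Tendsto (fun k : ℕ => f (y ⊓ k • x)) atTop (𝓝 c) := fun y =>
    ⟨_, tendsto_atTop_ciSup
      (fun m n hmn => dual_apply_mono hf (inf_le_inf_left _ (nsmul_le_nsmul_left hx hmn)))
      ⟨f y, by rintro _ ⟨k, rfl⟩; exact dual_apply_mono hf inf_le_left⟩⟩
  choose p hp using hlim
  have hp0 : ∀ y, 0 ≤ y → 0 ≤ p y := fun y hy =>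
    ge_of_tendsto' (hp y) fun k => dual_apply_nonneg hf (le_inf hy (nsmul_nonneg hx k))
  have hpf : ∀ y, 0 ≤ y → p y ≤ f y := fun y _ =>
    le_of_tendsto' (hp y) fun k => dual_apply_mono hf inf_le_left
  obtain ⟨g, hg⟩ := exists_dual_eq_of_additive p hp0 hpf fun y z hy hz => by
    apply le_antisymm
    · refine le_of_tendsto_of_tendsto' (hp (y + z)) ((hp y).add (hp z)) fun k => ?_
      rw [← map_add]
      exact dual_apply_mono hf (add_inf_le_inf_add_inf hy hz (nsmul_nonneg hx k))
    -- The factor 2 is harmless in the limit and makes room for `y ⊓ k • x + z ⊓ k • x ≤ (y + z) ⊓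
    -- (2 * k) • x`.
    · have h2 : Tendsto (fun k : ℕ => f ((y + z) ⊓ (2 * k) • x)) atTop (𝓝 (p (y + z))) :=
        (hp (y + z)).comp (tendsto_id.const_mul_atTop' two_pos)
      refine le_of_tendsto_of_tendsto' ((hp y).add (hp z)) h2 fun k => ?_
      rw [← map_add]
      refine dual_apply_mono hf (le_inf (add_le_add inf_le_left inf_le_left) ?_)
      rw [two_mul, add_smul]
      exact add_le_add inf_le_right inf_le_right
  exact ⟨g, fun y hy => (hp0 y hy).trans (hg y hy).ge, fun y hy => (hg y hy).trans_le (hpf y hy),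
    fun y hy => hg y hy ▸ hp y⟩

namespace IsBandPart

variable {f g : StrongDual ℝ E} {x : E}

theorem apply_inf_le (h : IsBandPart f x g) (hf : 0 ≤ f) (hx : 0 ≤ x) {y : E} (hy : 0 ≤ y)
    (k : ℕ) : f (y ⊓ k • x) ≤ g y :=
  Monotone.ge_of_tendsto
    (fun _ _ hmn => dual_apply_mono hf (inf_le_inf_left _ (nsmul_le_nsmul_left hx hmn)))
    (h.tendsto y hy) k

theorem apply_self (h : IsBandPart f x g) (hf : 0 ≤ f) (hx : 0 ≤ x) : g x = f x := by
  refine le_antisymm (h.le x hx) ?_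
  simpa using h.apply_inf_le hf hx hx 1

theorem apply_eq_zero (h : IsBandPart f x g) (hx : 0 ≤ x) {y : E} (hy : 0 ≤ y) (hxy : x ⊓ y = 0) :
    g y = 0 := by
  refine tendsto_nhds_unique (h.tendsto y hy) ?_
  refine tendsto_const_nhds.congr fun k => ?_
  rw [inf_comm, nsmul_inf_eq_zero hx hy hxy, map_zero]

/-- For large `k`, the vector `y ⊓ k • x` splits `y`: `g'` vanishes on it, and `g` is small on the
remainder. -/
theorem inf_eq_zero (h : IsBandPart f x g) (hf : 0 ≤ f) (hx : 0 ≤ x) {f' g' : StrongDual ℝ E}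
    {x' : E} (h' : IsBandPart f' x' g') (hx' : 0 ≤ x') (hxx' : x ⊓ x' = 0) : g ⊓ g' = 0 := by
  refine inf_eq_zero_of_exists_split h.nonneg h'.nonneg fun y hy δ hδ => ?_
  obtain ⟨k, hk⟩ := ((h.tendsto y hy).eventually (lt_mem_nhds (sub_lt_self _ hδ))).exists
  have hv0 : 0 ≤ y ⊓ k • x := le_inf hy (nsmul_nonneg hx k)
  refine ⟨y ⊓ k • x, ⟨hv0, inf_le_left⟩, ?_⟩
  have h1 : g' (y ⊓ k • x) = 0 := h'.apply_eq_zero hx' hv0 <| by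
    rw [inf_comm]
    exact inf_eq_zero_of_le hv0 hx' inf_le_right le_rfl (nsmul_inf_eq_zero hx hx' hxx' k)
  have h2 : f (y ⊓ k • x) ≤ g (y ⊓ k • x) := by
    simpa [inf_assoc] using h.apply_inf_le hf hx hv0 k
  rw [h1, map_sub]
  linarith

end IsBandPart

/-- With `b` the component of `g` on the band of `a⁺`, the functional `b - (g - b)` agrees with `g`
at `a⁺` and with `-g` at `a⁻`. -/
theorem exists_abs_le_apply_eq {g : StrongDual ℝ E} (hg : 0 ≤ g) (a : E) :
    ∃ h : StrongDual ℝ E, |h| ≤ g ∧ h a = g |a| := by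
  obtain ⟨b, hb⟩ := exists_isBandPart hg (posPart_nonneg a)
  refine ⟨b + b - g, sup_le (fun y hy => ?_) (fun y hy => ?_), ?_⟩
  · have := hb.le y hy
    simp only [sub_apply, add_apply]
    linarith
  · have := dual_apply_nonneg hb.nonneg hy
    simp only [neg_apply, sub_apply, add_apply]
    linarith
  · have h1 := hb.apply_self hg (posPart_nonneg a)
    have h2 := hb.apply_eq_zero (posPart_nonneg a) (negPart_nonneg a)
      (posPart_inf_negPart_eq_zero a)
    have h3 : b a = g a⁺ := by
      conv_lhs => rw [← posPart_sub_negPart a, map_sub, h1, h2, sub_zero]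
    have h4 : g a = g a⁺ - g a⁻ := by rw [← map_sub, posPart_sub_negPart]
    have h5 : g |a| = g a⁺ + g a⁻ := by rw [← map_add, posPart_add_negPart]
    simp only [sub_apply, add_apply, h3, h4, h5]
    ring

/-! ### From almost limited to L-weakly compact -/

theorem exists_nonneg_dual_norm_le {x : E} (hx : 0 ≤ x) :
    ∃ f : StrongDual ℝ E, 0 ≤ f ∧ (∀ y, f y ≤ ‖y‖) ∧ ‖x‖ ≤ f x := by
  obtain ⟨f, hf, hfx⟩ := exists_dual_vector'' ℝ x
  refine ⟨dualPosPart f, fun y hy => ?_, fun y => ?_, ?_⟩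
  · rw [dualPosPart_apply f hy]
    exact posPartOn_nonneg f hy
  · exact (le_abs_self _).trans ((dualPosPartHom_bound f y).trans
      (mul_le_of_le_one_left (norm_nonneg _) hf))
  · rw [dualPosPart_apply f hx]
    exact (le_of_eq hfx.symm).trans (le_posPartOn f hx le_rfl)

theorem isAlmostLimited_singleton (u : E) : IsAlmostLimited {u} :=
  ⟨Bornology.isBounded_singleton, fun f _ hf => by
    rw [tendstoUniformlyOn_singleton_iff_tendsto]
    exact tendsto_toWeakDual_zero_iff.1 hf u⟩

theorem IsLWeaklyCompact.isDisjointNullBelow {A : Set E} (hA : IsLWeaklyCompact A) {x : E}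
    (hx : x ∈ A) : IsDisjointNullBelow |x| := fun y hy hyd =>
  hA.2 y (fun n => ⟨x, hx, by rw [abs_of_nonneg (hy n).1]; exact (hy n).2⟩) hyd

theorem IsAlmostLimited.isLWeaklyCompact (hE : HasOrderContinuousNorm E) [IsOrderedModule ℝ E]
    {A : Set E} (hA : IsAlmostLimited A) : IsLWeaklyCompact A := by
  refine ⟨hA.1, fun x hxA hx => ?_⟩
  choose a haA hxa using hxA
  choose F hF0 hF1 hFx using fun n => exists_nonneg_dual_norm_le (abs_nonneg (x n))
  choose g hg using fun n => exists_isBandPart (hF0 n) (abs_nonneg (x n))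
  choose h hhg hha using fun n => exists_abs_le_apply_eq (hg n).nonneg (a n)
  have hdisj : IsDisjointSeq h := fun m n hmn =>
    inf_eq_zero_of_le (abs_nonneg _) (abs_nonneg _) (hhg m) (hhg n)
      ((hg m).inf_eq_zero (hF0 m) (abs_nonneg _) (hg n) (abs_nonneg _) (hx hmn))
  have hg0 : ∀ y, 0 ≤ y → Tendsto (fun n => g n y) atTop (𝓝 0) := by
    intro y hy
    have hk : ∀ n : ℕ, ∃ k : ℕ, g n y - 1 / ((n : ℝ) + 1) < F n (y ⊓ k • |x n|) := fun n =>
      (((hg n).tendsto y hy).eventually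
        (lt_mem_nhds (sub_lt_self _ (by positivity : (0 : ℝ) < 1 / ((n : ℝ) + 1))))).exists
    choose k hk using hk
    have hv0 : ∀ n, 0 ≤ y ⊓ k n • |x n| := fun n => le_inf hy (nsmul_nonneg (abs_nonneg _) _)
    -- These vectors lie in `[0, y]` and inherit disjointness from the `x n`; this is where order
    -- continuity enters.
    have hv : Tendsto (fun n => ‖y ⊓ k n • |x n|‖) atTop (𝓝 0) := by
      refine HasOrderContinuousNorm.isDisjointNullBelow hE y _ (fun n => ⟨hv0 n, inf_le_left⟩)
        (isDisjointSeq_of_nonneg hv0 fun m n hmn => ?_)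
      refine inf_eq_zero_of_le (hv0 m) (hv0 n) inf_le_right inf_le_right ?_
      refine nsmul_inf_eq_zero (abs_nonneg _) (nsmul_nonneg (abs_nonneg _) _) ?_ _
      rw [inf_comm]
      exact nsmul_inf_eq_zero (abs_nonneg _) (abs_nonneg _) (hx hmn.ne') _
    refine squeeze_zero (fun n => dual_apply_nonneg (hg n).nonneg hy) (fun n => ?_)
      (by simpa only [add_zero] using hv.add tendsto_one_div_add_atTop_nhds_zero_nat)
    have h1 := hk n
    have h2 := hF1 n (y ⊓ k n • |x n|)
    linarith
  have hunif := hA.2 h hdisj (tendsto_toWeakDual_zero_iff.2 fun y =>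
    squeeze_zero_norm (fun n => (abs_dual_apply_le (h n) y).trans (hhg n _ (abs_nonneg y)))
      (hg0 _ (abs_nonneg y)))
  rw [tendstoUniformlyOn_zero_iff] at hunif
  rw [Metric.tendsto_nhds]
  intro ε hε
  filter_upwards [hunif ε hε] with n hn
  rw [Real.dist_eq, sub_zero, abs_norm, ← norm_abs_eq_norm]
  calc ‖|x n|‖ ≤ F n |x n| := hFx n
    _ = g n |x n| := ((hg n).apply_self (hF0 n) (abs_nonneg _)).symm
    _ ≤ g n |a n| := dual_apply_mono (hg n).nonneg (hxa n)
    _ = h n (a n) := (hha n).symm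
    _ ≤ |h n (a n)| := le_abs_self _
    _ < ε := hn _ (haA n)

end Dual

/-! ### From L-weakly compact to almost limited -/

section UniformConvergence

variable {E : Type*} [NormedAddCommGroup E] [NormedSpace ℝ E] [Lattice E] [HasSolidNorm E]
  [IsOrderedAddMonoid E] [IsOrderedModule ℝ E] [CompleteSpace E]

/-- Disjointness yields `v k ∈ [0, u]` carrying at least `ε / 2` of `g k` and almost nothing of the
earlier `g i`. The upper limit `w` of the `v k` exists in norm and satisfies `g i w ≤ 0` for every
`i`. The tail suprema `z k ≥ v k` converge to `w` in norm, so uniform boundedness gives `ε / 2 ≤ g k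
(z k) ≤ M * ‖z k - w‖ → 0`. -/
theorem not_forall_le_apply_of_isDisjointNullBelow {u : E} (hu0 : 0 ≤ u)
    (hu : IsDisjointNullBelow u) {g : ℕ → StrongDual ℝ E} (hg0 : ∀ n, 0 ≤ g n)
    (hg : ∀ i j, i ≠ j → g i ⊓ g j = 0) {M : ℝ} (hM : ∀ n y, 0 ≤ y → g n y ≤ M * ‖y‖) {ε : ℝ}
    (hε : 0 < ε) : ¬ ∀ n, ε ≤ g n u := by
  intro hgu
  have hv : ∀ k : ℕ, ∃ v ∈ Set.Icc 0 u,
      g k (u - v) + (∑ i ∈ Finset.range k, g i) v < min (ε / 2) ((1 / 2) ^ k) := fun k =>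
    exists_split_of_inf_eq_zero (by
      rw [inf_comm]
      exact sum_inf_eq_zero _ (fun i _ => hg0 i) (hg0 k)
        fun i hi => hg i k (Finset.mem_range.1 hi).ne) hu0 (by positivity)
  choose v hvu hv using hv
  have hsum0 : ∀ k, 0 ≤ (∑ i ∈ Finset.range k, g i) (v k) := fun k =>
    dual_apply_nonneg (Finset.sum_nonneg fun i _ => hg0 i) (hvu k).1
  have hdiag : ∀ k, ε / 2 ≤ g k (v k) := fun k => by
    have h1 := (hv k).trans_le (min_le_left _ _)
    have h2 := hsum0 k
    have h3 := hgu k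
    rw [map_sub] at h1
    linarith
  have hoff : ∀ i k, i < k → g i (v k) ≤ (1 / 2) ^ k := fun i k hik => by
    have h1 := (hv k).trans_le (min_le_right _ _)
    have h2 := dual_apply_nonneg (hg0 k) (sub_nonneg.2 (hvu k).2)
    have h3 : g i ≤ ∑ i ∈ Finset.range k, g i :=
      Finset.single_le_sum (f := g) (fun i _ => hg0 i) (Finset.mem_range.2 hik)
    have h4 := h3 _ (hvu k).1
    linarith
  -- Finite suprema of the tail from `k`; their norm limit `z k` plays the role of the tail
  -- supremum.
  let s : ℕ → ℕ → E := fun k m => partialSups (fun i => v (k + i)) m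
  have hsmono : ∀ k, Monotone (s k) := fun k => (partialSups fun i => v (k + i)).monotone
  have hs0 : ∀ k m, 0 ≤ s k m := fun k m =>
    (hvu (k + 0)).1.trans (le_partialSups_of_le (fun i => v (k + i)) (Nat.zero_le m))
  have hsu : ∀ k m, s k m ≤ u := fun k m => partialSups_le _ _ _ fun i _ => (hvu _).2
  have hsm : ∀ k m, s k m ∈ Set.Icc 0 u := fun k m => ⟨hs0 k m, hsu k m⟩
  choose z hz using fun k => cauchySeq_tendsto_of_complete (hu.cauchySeq (hsmono k) (hsm k))
  have hsz : ∀ k m, s k m ≤ z k := fun k m => (hsmono k).ge_of_tendsto (hz k) m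
  have hvz : ∀ k i, v (k + i) ≤ z k := fun k i =>
    (le_partialSups (fun i => v (k + i)) i).trans (hsz k i)
  have hz0 : ∀ k, z k ∈ Set.Icc 0 u := fun k =>
    ⟨(hs0 k 0).trans (hsz k 0), le_of_tendsto' (hz k) (hsu k)⟩
  have hzanti : Antitone z := antitone_nat_of_succ_le fun k =>
    le_of_tendsto' (hz (k + 1)) fun m => partialSups_le _ _ _ fun i _ => by
      have := hvz k (i + 1)
      rwa [show k + (i + 1) = k + 1 + i by ring] at this
  have hgz : ∀ i k, i < k → g i (z k) ≤ 2 * (1 / 2) ^ k := by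
    intro i k hik
    refine le_of_tendsto' (((g i).continuous.tendsto _).comp (hz k)) fun m => ?_
    have h1 : s k m ≤ ∑ l ∈ Finset.range (m + 1), v (k + l) :=
      partialSups_le _ _ _ fun l hl => Finset.single_le_sum (f := fun l => v (k + l))
        (fun l _ => (hvu _).1) (Finset.mem_range.2 (Nat.lt_succ_of_le hl))
    calc g i (s k m) ≤ g i (∑ l ∈ Finset.range (m + 1), v (k + l)) := dual_apply_mono (hg0 i) h1
      _ = ∑ l ∈ Finset.range (m + 1), g i (v (k + l)) := map_sum _ _ _
      _ ≤ ∑ l ∈ Finset.range (m + 1), (1 / 2 : ℝ) ^ k * (1 / 2) ^ l :=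
          Finset.sum_le_sum fun l _ => by
            rw [← pow_add]; exact hoff i (k + l) (by omega)
      _ = (1 / 2) ^ k * ∑ l ∈ Finset.range (m + 1), (1 / 2 : ℝ) ^ l := by rw [Finset.mul_sum]
      _ ≤ (1 / 2) ^ k * 2 := by gcongr; exact sum_geometric_two_le _
      _ = 2 * (1 / 2) ^ k := mul_comm _ _
  obtain ⟨w, hw⟩ := cauchySeq_tendsto_of_complete (hu.cauchySeq_of_antitone hzanti hz0)
  have hwz : ∀ k, w ≤ z k := fun k => hzanti.le_of_tendsto hw k
  have hgw : ∀ i, g i w ≤ 0 := by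
    intro i
    have ht : Tendsto (fun k : ℕ => 2 * (1 / 2 : ℝ) ^ k) atTop (𝓝 0) := by
      simpa using (tendsto_pow_atTop_nhds_zero_of_lt_one (r := (1 / 2 : ℝ)) (by norm_num)
        (by norm_num)).const_mul 2
    refine ge_of_tendsto ht ?_
    filter_upwards [eventually_gt_atTop i] with k hk
    exact (dual_apply_mono (hg0 i) (hwz k)).trans (hgz i k hk)
  have hlim : Tendsto (fun k => M * ‖z k - w‖) atTop (𝓝 0) := by
    simpa using (tendsto_iff_norm_sub_tendsto_zero.1 hw).const_mul M
  have : ε / 2 ≤ 0 := ge_of_tendsto' hlim fun k => by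
    have h1 := hM k (z k - w) (sub_nonneg.2 (hwz k))
    have h2 := dual_apply_mono (hg0 k) (hvz k 0)
    have h3 := hdiag k
    have h4 := hgw k
    rw [map_sub] at h1
    rw [add_zero] at h2
    linarith
  linarith

theorem IsDisjointNullBelow.tendsto_apply {u : E} (hu0 : 0 ≤ u)
    (hu : IsDisjointNullBelow u) {g : ℕ → StrongDual ℝ E} (hg0 : ∀ n, 0 ≤ g n)
    (hg : ∀ i j, i ≠ j → g i ⊓ g j = 0) {M : ℝ} (hM : ∀ n y, 0 ≤ y → g n y ≤ M * ‖y‖) :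
    Tendsto (fun n => g n u) atTop (𝓝 0) := by
  rw [Metric.tendsto_nhds]
  by_contra! hcon
  obtain ⟨ε, hε, hcon⟩ := hcon
  obtain ⟨φ, hφ, hφε⟩ := extraction_of_frequently_atTop hcon
  refine not_forall_le_apply_of_isDisjointNullBelow hu0 hu (g := g ∘ φ) (fun n => hg0 _)
    (fun i j hij => hg _ _ (hφ.injective.ne hij)) (fun n => hM _) hε fun n => ?_
  have := hφε n
  rwa [Real.dist_eq, sub_zero, abs_of_nonneg (dual_apply_nonneg (hg0 _) hu0)] at this

theorem posPart_sub_smul_inf_eq_zero {a b : E} {c : ℝ} (hc : 1 ≤ c) :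
    (a - c • b)⁺ ⊓ (b - c⁻¹ • a)⁺ = 0 := by
  have hc0 : 0 < c := one_pos.trans_le hc
  refine inf_eq_zero_of_le (posPart_nonneg _) (posPart_nonneg _) le_rfl
    (sup_le ?_ (posPart_nonneg _)) (posPart_sub_inf_posPart_sub a (c • b))
  calc b - c⁻¹ • a = c⁻¹ • (c • b - a) := by
        rw [smul_sub, smul_smul, inv_mul_cancel₀ hc0.ne', one_smul]
    _ ≤ c⁻¹ • (c • b - a)⁺ := smul_le_smul_of_nonneg_left (le_posPart _) (inv_pos.2 hc0).le
    _ ≤ (1 : ℝ) • (c • b - a)⁺ :=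
        smul_le_smul_of_nonneg_right (inv_le_one_of_one_le₀ hc) (posPart_nonneg _)
    _ = (c • b - a)⁺ := one_smul _ _

/-- A bounded positive sequence on which positive functionals are large along the diagonal and
rapidly small below it dominates a disjoint sequence that is not norm null. -/
theorem exists_isDisjointSeq_le_of_apply_small {x : ℕ → E} (hx0 : ∀ n, 0 ≤ x n) {R : ℝ}
    (hR : ∀ n, ‖x n‖ ≤ R) {g : ℕ → StrongDual ℝ E} (hg0 : ∀ n, 0 ≤ g n) {M : ℝ}
    (hM : ∀ n y, 0 ≤ y → g n y ≤ M * ‖y‖) {ε : ℝ} (hε : 0 < ε) (hdiag : ∀ n, ε ≤ g n (x n))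
    (hoff : ∀ i j, i < j → g j (x i) ≤ ε / 4 * (1 / 8) ^ j) :
    ∃ w : ℕ → E, (∀ n, w n ∈ Set.Icc 0 (x n)) ∧ IsDisjointSeq w ∧
      ¬ Tendsto (fun n => ‖w n‖) atTop (𝓝 0) := by
  have hsum : Summable fun i => (1 / 2 : ℝ) ^ i • x i := by
    refine Summable.of_norm_bounded (g := fun i => (1 / 2 : ℝ) ^ i * R)
      (summable_geometric_two.mul_right R) fun i => ?_
    rw [norm_smul, norm_pow, Real.norm_of_nonneg (by norm_num : (0 : ℝ) ≤ 1 / 2)]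
    gcongr
    exact hR i
  have hterm : ∀ i, 0 ≤ (1 / 2 : ℝ) ^ i • x i := fun i => smul_nonneg (by positivity) (hx0 i)
  set u : E := ∑' i, (1 / 2 : ℝ) ^ i • x i with hu_def
  have hxu : ∀ i, (1 / 2 : ℝ) ^ i • x i ≤ u := fun i => hsum.le_tsum i fun j _ => hterm j
  have hu0 : 0 ≤ u := (hterm 0).trans (hxu 0)
  let S : ℕ → E := fun n => ∑ i ∈ Finset.range n, x i
  have hS0 : ∀ n, 0 ≤ S n := fun n => Finset.sum_nonneg fun i _ => hx0 i
  -- For `m < n`, the `S n` term gives `d n ≤ x n - 4 ^ n • x m`, and the `u` term gives `d m ≤ x m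
  -- - (4 ^ n)⁻¹ • x n`, because `(4 ^ n)⁻¹ • x n ≤ (1 / 2) ^ n • u`. The positive parts of these
  -- bounds are disjoint.
  let d : ℕ → E := fun n => x n - (4 : ℝ) ^ n • S n - (1 / 2 : ℝ) ^ n • u
  have h4S : ∀ n, 0 ≤ (4 : ℝ) ^ n • S n := fun n => smul_nonneg (by positivity) (hS0 n)
  have h2u : ∀ n, 0 ≤ (1 / 2 : ℝ) ^ n • u := fun n => smul_nonneg (by positivity) hu0
  refine ⟨fun n => (d n)⁺, fun n => ⟨posPart_nonneg _, sup_le ?_ (hx0 n)⟩,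
    isDisjointSeq_of_nonneg (fun n => posPart_nonneg _) fun m n hmn => ?_, fun hlim => ?_⟩
  · exact (sub_le_self _ (h2u n)).trans (sub_le_self _ (h4S n))
  · rw [inf_comm]
    refine inf_eq_zero_of_le (posPart_nonneg _) (posPart_nonneg _) (posPart_mono ?_)
      (posPart_mono ?_) (posPart_sub_smul_inf_eq_zero (a := x n) (b := x m) (c := (4 : ℝ) ^ n)
        (one_le_pow₀ (by norm_num)))
    · refine (sub_le_self _ (h2u n)).trans (sub_le_sub_left ?_ _)
      exact smul_le_smul_of_nonneg_left
        (Finset.single_le_sum (f := x) (fun i _ => hx0 i) (Finset.mem_range.2 hmn)) (by positivity)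
    · refine (sub_le_sub_right (sub_le_self _ (h4S m)) _).trans (sub_le_sub_left ?_ _)
      calc ((4 : ℝ) ^ n)⁻¹ • x n = (1 / 2 : ℝ) ^ n • (1 / 2 : ℝ) ^ n • x n := by
            rw [smul_smul, ← mul_pow, ← inv_pow]; norm_num
        _ ≤ (1 / 2 : ℝ) ^ n • u := smul_le_smul_of_nonneg_left (hxu n) (by positivity)
        _ ≤ (1 / 2 : ℝ) ^ m • u := smul_le_smul_of_nonneg_right
            (pow_le_pow_of_le_one (by norm_num) (by norm_num) hmn.le) hu0
  · have hlim' : Tendsto (fun n : ℕ => M * ‖(d n)⁺‖ + (1 / 2 : ℝ) ^ n * (M * ‖u‖)) atTop (𝓝 0) := by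
      simpa using (hlim.const_mul M).add ((tendsto_pow_atTop_nhds_zero_of_lt_one
        (r := (1 / 2 : ℝ)) (by norm_num) (by norm_num)).mul_const (M * ‖u‖))
    have : ε - ε / 4 ≤ 0 := ge_of_tendsto' hlim' fun n => by
      have h1 := hM n _ (posPart_nonneg (d n))
      have h2 := dual_apply_mono (hg0 n) (le_posPart (d n))
      have h3 : g n (d n) = g n (x n) - 4 ^ n * g n (S n) - (1 / 2) ^ n * g n u := by
        simp only [d, map_sub, map_smul, smul_eq_mul]
      -- The decay `(1 / 8) ^ n` absorbs the weight `4 ^ n` and the `n` summands, since `n * (1 / 2)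
      -- ^ n ≤ 1`.
      have h4 : 4 ^ n * g n (S n) ≤ ε / 4 := by
        have h5 : g n (S n) ≤ n * (ε / 4 * (1 / 8) ^ n) := by
          have := Finset.sum_le_card_nsmul (Finset.range n) (fun i => g n (x i)) _
            fun i hi => hoff i n (Finset.mem_range.1 hi)
          simpa only [S, map_sum, Finset.card_range, nsmul_eq_mul] using this
        have h6 : (n : ℝ) * (1 / 2) ^ n ≤ 1 := by
          rw [one_div, inv_pow, mul_inv_le_iff₀ (by positivity), one_mul]
          exact_mod_cast Nat.lt_two_pow_self.le
        calc 4 ^ n * g n (S n) ≤ 4 ^ n * (n * (ε / 4 * (1 / 8) ^ n)) := by gcongr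
          _ = ε / 4 * (n * (4 ^ n * (1 / 8) ^ n)) := by ring
          _ = ε / 4 * (n * (1 / 2) ^ n) := by rw [← mul_pow]; norm_num
          _ ≤ ε / 4 * 1 := by gcongr
          _ = ε / 4 := mul_one _
      have h7 : (1 / 2 : ℝ) ^ n * g n u ≤ (1 / 2) ^ n * (M * ‖u‖) := by
        gcongr
        exact hM n u hu0
      have h8 := hdiag n
      linarith
    linarith

theorem IsLWeaklyCompact.isAlmostLimited {A : Set E} (hA : IsLWeaklyCompact A) :
    IsAlmostLimited A := by
  refine ⟨hA.1, fun f hf hf0 => ?_⟩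
  rw [tendsto_toWeakDual_zero_iff] at hf0
  obtain ⟨C, hC⟩ := banach_steinhaus (g := f) fun x => by
    obtain ⟨c, hc⟩ := (hf0 x).norm.bddAbove_range
    exact ⟨c, fun n => hc ⟨n, rfl⟩⟩
  obtain ⟨R, hR⟩ := hA.1.exists_norm_le
  rw [tendstoUniformlyOn_zero_iff]
  by_contra! hcon
  obtain ⟨ε, hε, hcon⟩ := hcon
  obtain ⟨φ, hφ, hφε⟩ := extraction_of_frequently_atTop hcon
  choose x hxA hx using hφε
  let g : ℕ → StrongDual ℝ E := fun n => |f (φ n)|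
  have hg0 : ∀ n, 0 ≤ g n := fun n => abs_nonneg _
  have hg : ∀ i j, i ≠ j → g i ⊓ g j = 0 := fun i j hij => hf (hφ.injective.ne hij)
  have hM : ∀ n y, 0 ≤ y → g n y ≤ 2 * C * ‖y‖ := fun n y hy =>
    (abs_dual_apply_le_norm _ hy).trans (by gcongr; exact hC _)
  have hsmall : ∀ m, Tendsto (fun n => g n |x m|) atTop (𝓝 0) := fun m =>
    (hA.isDisjointNullBelow (hxA m)).tendsto_apply (abs_nonneg _) hg0 hg hM
  have hnext : ∀ j N : ℕ, ∃ n, N < n ∧ ∀ m ≤ N, g n |x m| ≤ ε / 4 * (1 / 8) ^ j := fun j N => by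
    have hev : ∀ᶠ n in atTop, ∀ m ∈ Set.Iic N, g n |x m| ≤ ε / 4 * (1 / 8) ^ j :=
      (eventually_all_finite (Set.finite_Iic N)).2 fun m _ =>
        (hsmall m).eventually (ge_mem_nhds (by positivity))
    exact ((eventually_gt_atTop N).and hev).exists
  choose ψ hψ hψε using hnext
  let k : ℕ → ℕ := fun n => Nat.rec 0 (fun j N => ψ (j + 1) N) n
  have hk : ∀ j, k (j + 1) = ψ (j + 1) (k j) := fun j => rfl
  have hkm : StrictMono k := strictMono_nat_of_lt_succ fun j => by rw [hk]; exact hψ _ _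
  obtain ⟨w, hw, hwd, hwt⟩ := exists_isDisjointSeq_le_of_apply_small (x := fun n => |x (k n)|)
    (fun n => abs_nonneg _) (R := R) (fun n => by rw [norm_abs_eq_norm]; exact hR _ (hxA _))
    (g := fun n => g (k n)) (fun n => hg0 _) (fun n => hM _) hε
    (fun n => (hx (k n)).trans (abs_dual_apply_le _ _)) fun i j hij => by
      obtain ⟨j, rfl⟩ : ∃ j', j = j' + 1 := ⟨j - 1, by omega⟩
      exact hψε (j + 1) (k j) (k i) (hkm.monotone (Nat.le_of_lt_succ hij))
  exact hwt (hA.2 w (fun n => ⟨x (k n), hxA _, by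
    rw [abs_of_nonneg (hw n).1]; exact (hw n).2⟩) hwd)

end UniformConvergence

end BanachLattice

theorem theorem2 {E : Type*} [NormedAddCommGroup E] [NormedSpace ℝ E] [CompleteSpace E]
    [Lattice E] [HasSolidNorm E] [IsOrderedAddMonoid E] [IsOrderedModule ℝ E] :
    (∀ A : Set E, BanachLattice.IsLWeaklyCompact A → BanachLattice.IsAlmostLimited A) ∧
    (BanachLattice.HasOrderContinuousNorm E ↔
      ∀ A : Set E, BanachLattice.IsAlmostLimited A → BanachLattice.IsLWeaklyCompact A) := by
  refine ⟨fun A hA => hA.isAlmostLimited, fun hE A hA => hA.isLWeaklyCompact hE, fun h => ?_⟩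
  refine BanachLattice.hasOrderContinuousNorm_of_isDisjointNullBelow fun u hu => ?_
  have := (h {u} (BanachLattice.isAlmostLimited_singleton u)).isDisjointNullBelow
    (Set.mem_singleton u)
  rwa [abs_of_nonneg hu] at this
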